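/- Let $\mathbb{F}_2^n$ carry the uniform distribution; for $f,g:\mathbb{F}_2^n\to\mathbb{C}$ put $(f,g)=2^{-n}\sum_{x}f(x)\overline{g(x)}$, $\|f\|_2^2=(f,f)$, and $\hat f(\omega)=\sum_{x}(-1)^{\langle\omega,x\rangle}f(x)$. For $S,\Sigma\subset\mathbb{F}_2^n$ let $V_S=\{f:\operatorname{supp} f\subset S\}$ and $\hat V_\Sigma=\{f:\operatorname{supp}\hat f\subset\Sigma\}$. For subspaces $V_1,V_2$ let $$\cos\angle(V_1,V_2)=\sup_{0\ne f_1\in V_1,\;0\ne f_2\in V_2}\frac{|(f_1,f_2)|}{\|f_1\|_2\|f_2\|_2}$$ (equal to $0$ if $V_1$ or $V_2$ is trivial). Let $|x|$ be the Hamming weight, $B_r=\{x\in\mathbb{F}_2^n:|x|\le r\}$ for real $r$, and $h(\rho)=-\rho\ln\rho-(1-\rho)\ln(1-\rho)$ with $0\ln 0=0$. **Theorem (uncertainty principle on $\mathbb{F}_2^n$).** (1) For any $\rho_1,\rho_2\in[0,1/2]$ with $(1-2\rho_1)^2+(1-2\rho_2)^2>1$ there exist $\epsilon>0$ and $n_0$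 such that for every $n\ge n_0$, every $S\subset\mathbb{F}_2^n$ with $|S|\le e^{nh(\rho_1)}$, and $\Sigma=B_{\rho_2n}$, $$\cos\angle(V_S,\hat V_\Sigma)\le e^{-n\epsilon}.$$ (2) Conversely, for any $\rho_1,\rho_2\in[0,1/2]$ with $(1-2\rho_1)^2+(1-2\rho_2)^2<1$ there exist $\epsilon>0$ and $n_0$ such that for every $n\ge n_0$, with $S=B_{\rho_1n}$ and $\Sigma=B_{\rho_2n}$, $$\cos\angle(V_S,\hat V_\Sigma)\ge 1-e^{-n\epsilon}.$$ (3) The conclusion of (2) also holds for $\rho_1,\rho_2\ge0$ with $\rho_1>1/2$ or $\rho_2>1/2$, provided the inequality in (2) holds after each $\rho_i$ is replaced by $\min(\rho_i,1/2)$. -/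

import Mathlib

namespace Hypercube

noncomputable section

/-- The hypercube `𝔽₂ⁿ`. -/
abbrev Cube (n : ℕ) : Type := Fin n → ZMod 2

/-- The inner product `(f, g) = 𝔼[f ḡ]`, expectation over the uniform distribution on `𝔽₂ⁿ`. -/
def cubeInner {n : ℕ} (f g : Cube n → ℂ) : ℂ :=
  (∑ x : Cube n, f x * starRingEnd ℂ (g x)) / 2 ^ n

/-- The norm `‖f‖₂ = (f, f)^{1/2}`. -/
def cubeNorm {n : ℕ} (f : Cube n → ℂ) : ℝ :=
  Real.sqrt (cubeInner f f).re

/-- The cosine of the angle between two subspaces: the supremum of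
`|(f₁, f₂)| / (‖f₁‖₂ ‖f₂‖₂)` over nonzero `f₁ ∈ V₁`, `f₂ ∈ V₂`
(it is `0` if one of the subspaces is trivial). -/
def cosAngle {n : ℕ} (V₁ V₂ : Submodule ℂ (Cube n → ℂ)) : ℝ :=
  sSup {c : ℝ | ∃ f₁ ∈ V₁, ∃ f₂ ∈ V₂, f₁ ≠ 0 ∧ f₂ ≠ 0 ∧
    c = ‖cubeInner f₁ f₂‖ / (cubeNorm f₁ * cubeNorm f₂)}

/-- The character `χ_v(x) = (-1)^{⟨v, x⟩}`. -/
def character {n : ℕ} (v x : Cube n) : ℂ := (-1) ^ (v ⬝ᵥ x).val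

/-- The Fourier transform `f̂(ω) = ∑ₓ χ_ω(x) f(x)`, as a linear map. -/
def fourier (n : ℕ) : (Cube n → ℂ) →ₗ[ℂ] (Cube n → ℂ) where
  toFun f := fun ω => ∑ x : Cube n, character ω x * f x
  map_add' f g := by
    funext ω
    simp [mul_add, Finset.sum_add_distrib]
  map_smul' c f := by
    funext ω
    simp [Finset.mul_sum, mul_left_comm]

/-- `V_S`: the functions supported in `S`. -/
def suppSpace {n : ℕ} (S : Set (Cube n)) : Submodule ℂ (Cube n → ℂ) where
  carrier := {f | Function.support f ⊆ S}
  zero_mem' := by simp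
  add_mem' {f g} hf hg :=
    (Function.support_add f g).trans (Set.union_subset hf hg)
  smul_mem' c f hf := (Function.support_const_smul_subset c f).trans hf

/-- `V̂_Σ`: the functions whose Fourier transform is supported in `Σ`. -/
def fourierSuppSpace {n : ℕ} (T : Set (Cube n)) : Submodule ℂ (Cube n → ℂ) :=
  (suppSpace T).comap (fourier n)

/-- The Hamming ball `B_r = {x : |x| ≤ r}` with real radius `r`. -/
def hammingBall (n : ℕ) (r : ℝ) : Set (Cube n) :=
  {x | (hammingNorm x : ℝ) ≤ r}

end

end Hypercube

/-! Upper bound. Let `A` be the adjacency operator of the cube, with eigenvalue `n - 2|ω|` on the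
character at `ω`. On spectrum in `B_{ρ₂n}` it is at least `n(1 - 2ρ₂)`. A Faber–Krahn inequality
bounds its quadratic form by `2n√(ρ(1-ρ))` on functions supported on at most `e^{nh(ρ)}` points. If
`f` lives on `S`, then `A^k f` lives on the `k`-neighbourhood of `S`; for `k = δn` this costs only a
slightly larger `ρ > ρ₁`. Comparing the two bounds on `A^k` gives `|(f,g)| ≤ (2√(ρ(1-ρ)) /
(1-2ρ₂))^k ‖f‖‖g‖`, and the ratio is below 1 for `ρ` near `ρ₁` exactly when `(1-2ρ₁)² + (1-2ρ₂)² >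
1`. Key lemmas: `sum_mul_shift_le_entropy`, `sqSum_adjacency_le`,
`norm_sum_mul_conj_le_of_fourierSupp`.

Lower bound. For a tensor power `f` of a unit vector `(a,b)`, both `|f|²` and the normalised `|f̂|²`
are product measures, of biases `(1-c)/2` and `(1-s)/2` with `c² + s² = 1`. By Chernoff, `f` is
exponentially close to both subspaces. -/

namespace Hypercube

/-! ### Norms and angles. -/

/-- The unnormalised squared `ℓ²` norm of a function on the cube. -/
noncomputable def sqSum {n : ℕ} (f : Cube n → ℂ) : ℝ := ∑ x, ‖f x‖ ^ 2

lemma sqSum_nonneg {n : ℕ} (f : Cube n → ℂ) : 0 ≤ sqSum f :=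
  Finset.sum_nonneg fun _ _ => by positivity

lemma sqSum_pos {n : ℕ} {f : Cube n → ℂ} (hf : f ≠ 0) : 0 < sqSum f := by
  obtain ⟨x, hx⟩ := Function.ne_iff.mp hf
  refine Finset.sum_pos' (fun _ _ => by positivity) ⟨x, Finset.mem_univ _, ?_⟩
  have : 0 < ‖f x‖ := norm_pos_iff.mpr hx
  positivity

lemma cubeNorm_eq {n : ℕ} (f : Cube n → ℂ) : cubeNorm f = √(sqSum f / 2 ^ n) := by
  have h : cubeInner f f = ((sqSum f / 2 ^ n : ℝ) : ℂ) := by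
    simp [cubeInner, sqSum, Complex.mul_conj']
  rw [cubeNorm, h, Complex.ofReal_re]

lemma cos_quotient_eq {n : ℕ} (f g : Cube n → ℂ) :
    ‖cubeInner f g‖ / (cubeNorm f * cubeNorm g) =
      ‖∑ x, f x * starRingEnd ℂ (g x)‖ / (√(sqSum f) * √(sqSum g)) := by
  have h2 : (0 : ℝ) < 2 ^ n := by positivity
  rw [cubeNorm_eq, cubeNorm_eq, cubeInner, norm_div, Real.sqrt_div (sqSum_nonneg f),
    Real.sqrt_div (sqSum_nonneg g), div_mul_div_comm, Real.mul_self_sqrt h2.le]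
  simp only [norm_pow, Complex.norm_ofNat]
  rw [div_div_div_cancel_right₀ h2.ne']

lemma norm_sum_mul_conj_le {ι : Type*} (s : Finset ι) (f g : ι → ℂ) :
    ‖∑ x ∈ s, f x * starRingEnd ℂ (g x)‖ ≤
      √(∑ x ∈ s, ‖f x‖ ^ 2) * √(∑ x ∈ s, ‖g x‖ ^ 2) := by
  refine (norm_sum_le _ _).trans ?_
  simp only [norm_mul, RCLike.norm_conj]
  exact Real.sum_mul_le_sqrt_mul_sqrt s _ _

lemma le_cosAngle {n : ℕ} {V₁ V₂ : Submodule ℂ (Cube n → ℂ)} {f g : Cube n → ℂ}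
    (hf : f ∈ V₁) (hg : g ∈ V₂) (hf0 : f ≠ 0) (hg0 : g ≠ 0) :
    ‖∑ x, f x * starRingEnd ℂ (g x)‖ / (√(sqSum f) * √(sqSum g)) ≤ cosAngle V₁ V₂ := by
  refine le_csSup ⟨1, ?_⟩ ⟨f, hf, g, hg, hf0, hg0, (cos_quotient_eq f g).symm⟩
  rintro _ ⟨f, -, g, -, -, -, rfl⟩
  rw [cos_quotient_eq]
  exact div_le_one_of_le₀ (norm_sum_mul_conj_le _ f g) (by positivity)

lemma cosAngle_le {n : ℕ} {V₁ V₂ : Submodule ℂ (Cube n → ℂ)} {c : ℝ} (hc : 0 ≤ c)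
    (h : ∀ f ∈ V₁, ∀ g ∈ V₂,
      ‖∑ x, f x * starRingEnd ℂ (g x)‖ ≤ c * (√(sqSum f) * √(sqSum g))) :
    cosAngle V₁ V₂ ≤ c := by
  refine Real.sSup_le ?_ hc
  rintro _ ⟨f, hf, g, hg, hf0, hg0, rfl⟩
  rw [cos_quotient_eq, div_le_iff₀]
  · exact h f hf g hg
  · exact mul_pos (Real.sqrt_pos.mpr (sqSum_pos hf0)) (Real.sqrt_pos.mpr (sqSum_pos hg0))

/-! ### Characters, Fourier inversion and Parseval. -/

lemma zmod_two_eq_zero_or_one (a : ZMod 2) : a = 0 ∨ a = 1 := by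
  revert a
  decide

lemma neg_one_pow_val_add (a b : ZMod 2) :
    (-1 : ℂ) ^ (a + b).val = (-1) ^ a.val * (-1) ^ b.val := by
  rw [ZMod.val_add, ← neg_one_pow_eq_pow_mod_two, pow_add]

lemma character_eq_prod {n : ℕ} (v x : Cube n) :
    character v x = ∏ i, (-1 : ℂ) ^ (v i * x i).val := by
  rw [character, dotProduct]
  induction (Finset.univ : Finset (Fin n)) using Finset.induction_on with
  | empty => simp
  | insert i s hi ih => rw [Finset.sum_insert hi, Finset.prod_insert hi, neg_one_pow_val_add, ih]

lemma character_comm {n : ℕ} (v x : Cube n) : character v x = character x v := by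
  rw [character, character, dotProduct_comm]

lemma character_add {n : ℕ} (v x y : Cube n) :
    character v (x + y) = character v x * character v y := by
  rw [character, dotProduct_add, neg_one_pow_val_add]; rfl

lemma conj_character {n : ℕ} (v x : Cube n) :
    starRingEnd ℂ (character v x) = character v x := by
  simp [character]

lemma sum_prod_apply {n : ℕ} {R : Type*} [CommSemiring R] (F : Fin n → ZMod 2 → R) :
    ∑ x : Cube n, ∏ i, F i (x i) = ∏ i, (F i 0 + F i 1) := by
  have h : ∀ i, F i 0 + F i 1 = ∑ a : ZMod 2, F i a := fun i => (Fin.sum_univ_two (F i)).symm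
  simp only [h]
  rw [Finset.prod_univ_sum, Fintype.piFinset_univ]

lemma sum_character_mul {n : ℕ} (x y : Cube n) :
    ∑ ω, character ω x * character ω y = if x = y then (2 : ℂ) ^ n else 0 := by
  simp only [character_eq_prod, ← Finset.prod_mul_distrib]
  rw [sum_prod_apply fun i a => (-1 : ℂ) ^ (a * x i).val * (-1) ^ (a * y i).val]
  have h : ∀ a b : ZMod 2, (-1 : ℂ) ^ (0 * a).val * (-1) ^ (0 * b).val +
      (-1) ^ (1 * a).val * (-1) ^ (1 * b).val = if a = b then 2 else 0 := by
    intro a b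
    rcases zmod_two_eq_zero_or_one a with rfl | rfl <;>
      rcases zmod_two_eq_zero_or_one b with rfl | rfl <;> norm_num [ZMod.val_one]
  simp only [h]
  split_ifs with hxy
  · simp [hxy]
  · obtain ⟨i, hi⟩ := Function.ne_iff.mp hxy
    exact Finset.prod_eq_zero (Finset.mem_univ i) (if_neg hi)

lemma fourier_apply {n : ℕ} (f : Cube n → ℂ) (ω : Cube n) :
    fourier n f ω = ∑ x, character ω x * f x := rfl

lemma fourier_fourier {n : ℕ} (f : Cube n → ℂ) : fourier n (fourier n f) = (2 : ℂ) ^ n • f := by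
  funext y
  simp only [fourier_apply, Finset.mul_sum, Pi.smul_apply, smul_eq_mul]
  rw [Finset.sum_comm]
  simp only [← mul_assoc, ← Finset.sum_mul, character_comm y, sum_character_mul]
  simp

lemma parseval {n : ℕ} (f g : Cube n → ℂ) :
    ∑ ω, fourier n f ω * starRingEnd ℂ (fourier n g ω) =
      2 ^ n * ∑ x, f x * starRingEnd ℂ (g x) := by
  have h : ∀ ω, fourier n f ω * starRingEnd ℂ (fourier n g ω) =
      ∑ x, f x * (character ω x * starRingEnd ℂ (fourier n g ω)) := by
    intro ω
    rw [fourier_apply, Finset.sum_mul]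
    exact Finset.sum_congr rfl fun _ _ => by ring
  simp only [h]
  rw [Finset.sum_comm, Finset.mul_sum]
  refine Finset.sum_congr rfl fun x _ => ?_
  rw [← Finset.mul_sum]
  have h2 := congrArg (starRingEnd ℂ) (congrFun (fourier_fourier g) x)
  rw [fourier_apply, map_sum] at h2
  simp only [map_mul, conj_character, Pi.smul_apply, smul_eq_mul, map_pow, map_ofNat,
    character_comm x] at h2
  rw [h2]
  ring

lemma sqSum_fourier {n : ℕ} (f : Cube n → ℂ) : sqSum (fourier n f) = 2 ^ n * sqSum f := by
  have h := parseval f f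
  simp only [Complex.mul_conj'] at h
  unfold sqSum
  exact_mod_cast h

/-! ### The adjacency operator and its spectrum. -/

/-- The adjacency operator of the hypercube graph. -/
def adjacency {n : ℕ} (f : Cube n → ℂ) : Cube n → ℂ := fun x => ∑ i, f (x + Pi.single i 1)

lemma single_add_single_self {n : ℕ} (x : Cube n) (i : Fin n) :
    x + Pi.single i 1 + Pi.single i 1 = x := by
  have h : (1 : ZMod 2) + 1 = 0 := by decide
  rw [add_assoc, ← Pi.single_add, h, Pi.single_zero, add_zero]

lemma sum_shift_single {n : ℕ} {M : Type*} [AddCommMonoid M] (i : Fin n) (F : Cube n → M) :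
    ∑ x : Cube n, F (x + Pi.single i 1) = ∑ x : Cube n, F x :=
  Equiv.sum_comp (Equiv.addRight (Pi.single i (1 : ZMod 2) : Cube n)) F

lemma character_single {n : ℕ} (ω : Cube n) (i : Fin n) :
    character ω (Pi.single i 1) = if ω i = 0 then 1 else -1 := by
  rw [character, dotProduct_single, mul_one]
  rcases zmod_two_eq_zero_or_one (ω i) with h | h <;> simp [h, ZMod.val_one]

lemma sum_character_single {n : ℕ} (ω : Cube n) :
    ∑ i, character ω (Pi.single i 1) = n - 2 * hammingNorm ω := by
  have h : ∀ i, character ω (Pi.single i 1) = 1 - 2 * if ω i ≠ 0 then (1 : ℂ) else 0 := by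
    intro i
    rw [character_single]
    by_cases h : ω i = 0 <;> norm_num [h]
  simp only [h, Finset.sum_sub_distrib, ← Finset.mul_sum, Finset.sum_boole, hammingNorm]
  simp

lemma fourier_adjacency {n : ℕ} (f : Cube n → ℂ) (ω : Cube n) :
    fourier n (adjacency f) ω = (n - 2 * hammingNorm ω) * fourier n f ω := by
  rw [← sum_character_single, Finset.sum_mul, fourier_apply]
  simp only [adjacency, Finset.mul_sum]
  rw [Finset.sum_comm]
  refine Finset.sum_congr rfl fun i _ => ?_
  rw [fourier_apply, Finset.mul_sum,
    ← sum_shift_single i fun x => character ω (Pi.single i 1) * (character ω x * f x)]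
  refine Finset.sum_congr rfl fun x _ => ?_
  have h : character ω (Pi.single i 1) * character ω (Pi.single i 1) = 1 := by
    rw [character_single]
    split_ifs <;> norm_num
  rw [character_add]
  linear_combination (-(character ω x * f (x + Pi.single i 1))) * h

lemma fourier_adjacency_iterate {n : ℕ} (f : Cube n → ℂ) (k : ℕ) (ω : Cube n) :
    fourier n (adjacency^[k] f) ω = (n - 2 * hammingNorm ω) ^ k * fourier n f ω := by
  induction k with
  | zero => simp
  | succ k ih => rw [Function.iterate_succ_apply', fourier_adjacency, ih, pow_succ']; ring

lemma pow_hammingNorm_eq_prod {n : ℕ} {R : Type*} [CommMonoid R] (z : R) (x : Cube n) :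
    z ^ hammingNorm x = ∏ i, if x i = 0 then 1 else z := by
  rw [Finset.prod_ite]
  simp [hammingNorm]

/-! ### The two-point inequality between `2√(p(1-p))` and entropy. -/

lemma sinh_div_mono {a b : ℝ} (ha : 0 < a) (hab : a ≤ b) :
    Real.sinh a / a ≤ Real.sinh b / b := by
  have hconv : ConvexOn ℝ (Set.Ici 0) Real.sinh := by
    refine MonotoneOn.convexOn_of_deriv (convex_Ici 0) Real.continuous_sinh.continuousOn
      Real.differentiable_sinh.differentiableOn ?_
    rw [Real.deriv_sinh]
    intro x hx y hy hxy
    rw [interior_Ici] at hx hy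
    rw [Real.cosh_le_cosh, abs_of_pos hx, abs_of_pos hy]
    exact hxy
  have hb : 0 < b := ha.trans_le hab
  have h := hconv.2 (Set.mem_Ici.mpr le_rfl) (Set.mem_Ici.mpr hb.le)
    (sub_nonneg.mpr ((div_le_one hb).mpr hab)) (by positivity : 0 ≤ a / b) (by ring)
  simp only [smul_eq_mul, mul_zero, Real.sinh_zero, zero_add] at h
  rw [div_mul_cancel₀ _ hb.ne'] at h
  rw [div_le_iff₀ ha]
  calc Real.sinh a ≤ a / b * Real.sinh b := h
    _ = Real.sinh b / b * a := by ring

/-- Half the logarithmic odds of `1 - p`. -/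
noncomputable def halfLogOdds (p : ℝ) : ℝ := (Real.log (1 - p) - Real.log p) / 2

/-- With `u = halfLogOdds p`, the derivatives of `2√(p(1-p))` and of `h(p)` are `2 sinh u` and `2u`.
Their ratio `sinh u / u` increases with `u`, so it decreases in `p` on `(0, 1/2)`: this is the
concavity behind the tangent bound. -/
lemma sinh_halfLogOdds {p : ℝ} (h0 : 0 < p) (h1 : p < 1) :
    Real.sinh (halfLogOdds p) = (1 - 2 * p) / (2 * √(p * (1 - p))) := by
  have hq : 0 < 1 - p := by linarith
  have e1 : Real.exp (halfLogOdds p) = √(1 - p) / √p := by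
    rw [halfLogOdds, sub_div, Real.exp_sub, ← Real.log_sqrt hq.le, ← Real.log_sqrt h0.le,
      Real.exp_log (Real.sqrt_pos.mpr hq), Real.exp_log (Real.sqrt_pos.mpr h0)]
  have hp' := Real.sqrt_pos.mpr h0
  have hq' := Real.sqrt_pos.mpr hq
  rw [Real.sinh_eq, Real.exp_neg, e1, Real.sqrt_mul h0.le, inv_div]
  have s1 := Real.sq_sqrt h0.le
  have s2 := Real.sq_sqrt hq.le
  field_simp
  linarith

lemma halfLogOdds_pos {p : ℝ} (h0 : 0 < p) (h1 : p < 1 / 2) : 0 < halfLogOdds p := by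
  have := Real.log_lt_log h0 (show p < 1 - p by linarith)
  rw [halfLogOdds]
  linarith

lemma halfLogOdds_anti {p q : ℝ} (h0 : 0 < p) (hpq : p ≤ q) (h1 : q < 1) :
    halfLogOdds q ≤ halfLogOdds p := by
  have h2 := Real.log_le_log h0 hpq
  have h3 := Real.log_le_log (show 0 < 1 - q by linarith) (show 1 - q ≤ 1 - p by linarith)
  rw [halfLogOdds, halfLogOdds]
  linarith

lemma hasDerivAt_two_sqrt_sub_entropy (m : ℝ) {p : ℝ} (h0 : 0 < p) (h1 : p < 1) :
    HasDerivAt (fun p => 2 * √(p * (1 - p)) - m * Real.binEntropy p)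
      (2 * Real.sinh (halfLogOdds p) - m * (2 * halfLogOdds p)) p := by
  have hpos : 0 < p * (1 - p) := mul_pos h0 (by linarith)
  have h2 : HasDerivAt (fun p : ℝ => p * (1 - p)) (1 - 2 * p) p := by
    have := (hasDerivAt_id p).mul ((hasDerivAt_id p).const_sub 1)
    refine this.congr_deriv ?_
    simp only [id]
    ring
  have h3 := ((h2.sqrt hpos.ne').const_mul 2).sub
    ((Real.hasDerivAt_binEntropy h0.ne' h1.ne).const_mul m)
  refine h3.congr_deriv ?_
  rw [sinh_halfLogOdds h0 h1, halfLogOdds]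
  ring

/-- The map `h(p) ↦ 2√(p(1-p))` lies below its tangent at `h(ρ)`. -/
lemma two_sqrt_le_tangent {ρ : ℝ} (h0 : 0 < ρ) (h1 : ρ < 1 / 2) :
    ∃ m : ℝ, 0 ≤ m ∧ ∀ p ∈ Set.Icc (0 : ℝ) 1,
      2 * √(p * (1 - p)) ≤
        2 * √(ρ * (1 - ρ)) + m * (Real.binEntropy p - Real.binEntropy ρ) := by
  set u := halfLogOdds ρ with hu
  have hupos : 0 < u := halfLogOdds_pos h0 h1
  set m := Real.sinh u / u with hm
  set g : ℝ → ℝ := fun p => 2 * √(p * (1 - p)) - m * Real.binEntropy p with hg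
  have hcont : Continuous g := by fun_prop
  have hderiv : ∀ {p : ℝ}, 0 < p → p < 1 / 2 → deriv g p =
      2 * Real.sinh (halfLogOdds p) - m * (2 * halfLogOdds p) := fun hp0 hp1 =>
    (hasDerivAt_two_sqrt_sub_entropy m hp0 (by linarith)).deriv
  have hdiff : ∀ {p : ℝ}, 0 < p → p < 1 / 2 → DifferentiableAt ℝ g p := fun hp0 hp1 =>
    (hasDerivAt_two_sqrt_sub_entropy m hp0 (by linarith)).differentiableAt
  have hmono : MonotoneOn g (Set.Icc 0 ρ) := by
    refine monotoneOn_of_deriv_nonneg (convex_Icc 0 ρ) hcont.continuousOn ?_ ?_ <;>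
      rw [interior_Icc]
    · exact fun p hp => (hdiff hp.1 (hp.2.trans h1)).differentiableWithinAt
    · intro p hp
      rw [hderiv hp.1 (hp.2.trans h1)]
      have := sinh_div_mono hupos (halfLogOdds_anti hp.1 hp.2.le (by linarith))
      rw [le_div_iff₀ (halfLogOdds_pos hp.1 (hp.2.trans h1))] at this
      linarith
  have hanti : AntitoneOn g (Set.Icc ρ (1 / 2)) := by
    refine antitoneOn_of_deriv_nonpos (convex_Icc ρ (1 / 2)) hcont.continuousOn ?_ ?_ <;>
      rw [interior_Icc]
    · exact fun p hp => (hdiff (h0.trans hp.1) hp.2).differentiableWithinAt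
    · intro p hp
      have hp0 := h0.trans hp.1
      rw [hderiv hp0 hp.2]
      have hpos := halfLogOdds_pos hp0 hp.2
      have := sinh_div_mono hpos (halfLogOdds_anti h0 hp.1.le (by linarith [hp.2]))
      rw [div_le_iff₀ hpos] at this
      linarith
  have hle : ∀ p ∈ Set.Icc (0 : ℝ) (1 / 2), g p ≤ g ρ := by
    intro p hp
    rcases le_total p ρ with h | h
    · exact hmono ⟨hp.1, h⟩ ⟨h0.le, le_rfl⟩ h
    · exact hanti ⟨le_rfl, h1.le⟩ ⟨h, hp.2⟩ h
  refine ⟨m, div_nonneg (Real.sinh_nonneg_iff.mpr hupos.le) hupos.le, fun p hp => ?_⟩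
  have key : g p ≤ g ρ := by
    rcases le_total p (1 / 2) with h | h
    · exact hle p ⟨hp.1, h⟩
    -- Both sides are invariant under `p ↦ 1 - p`.
    · have h2 := hle (1 - p) ⟨by linarith [hp.2], by linarith⟩
      simp only [hg, Real.binEntropy_one_sub, sub_sub_cancel] at h2
      simp only [hg]
      rwa [mul_comm (1 - p)] at h2
  simp only [hg] at key
  linarith

/-- Homogeneous form of the hypothesis: take `p = x/(x+y)` and multiply by `x + y`. The entropy
becomes the chain-rule defect of `negMulLog`. -/
lemma two_sqrt_mul_le {m σ η : ℝ}
    (h : ∀ p ∈ Set.Icc (0 : ℝ) 1, 2 * √(p * (1 - p)) ≤ σ + m * (Real.binEntropy p - η))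
    {x y : ℝ} (hx : 0 ≤ x) (hy : 0 ≤ y) :
    2 * (√x * √y) ≤ (σ - m * η) * (x + y) +
      m * (Real.negMulLog x + Real.negMulLog y - Real.negMulLog (x + y)) := by
  rcases hx.eq_or_lt with rfl | hx
  · have := h 0 (by simp)
    simp only [zero_mul, Real.sqrt_zero, mul_zero, Real.binEntropy_zero] at this
    simp only [Real.sqrt_zero, zero_mul, mul_zero, Real.negMulLog_zero, zero_add, sub_self]
    nlinarith
  rcases hy.eq_or_lt with rfl | hy
  · have := h 0 (by simp)
    simp only [zero_mul, Real.sqrt_zero, mul_zero, Real.binEntropy_zero] at this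
    simp only [Real.sqrt_zero, mul_zero, Real.negMulLog_zero, add_zero, sub_self]
    nlinarith
  have hs : 0 < x + y := add_pos hx hy
  have hp := h (x / (x + y)) ⟨by positivity, (div_le_one hs).mpr (by linarith)⟩
  have hq : 1 - x / (x + y) = y / (x + y) := by field_simp; ring
  rw [Real.binEntropy_eq_negMulLog_add_negMulLog_one_sub, hq, div_mul_div_comm,
    Real.sqrt_div (by positivity), Real.sqrt_mul_self hs.le, Real.sqrt_mul hx.le] at hp
  have h1 := mul_le_mul_of_nonneg_right hp hs.le
  have h2 : 2 * (√x * √y / (x + y)) * (x + y) = 2 * (√x * √y) := by field_simp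
  rw [h2] at h1
  refine h1.trans (le_of_eq ?_)
  simp only [Real.negMulLog, Real.log_div hx.ne' hs.ne', Real.log_div hy.ne' hs.ne']
  field_simp
  ring

/-! ### Logarithmic Sobolev and Faber–Krahn inequalities. -/

lemma sum_cube_succ {n : ℕ} {M : Type*} [AddCommMonoid M] (F : Cube (n + 1) → M) :
    ∑ x, F x = ∑ y : Cube n, F (Fin.cons 0 y) + ∑ y : Cube n, F (Fin.cons 1 y) := by
  rw [← (Fin.consEquiv fun _ : Fin (n + 1) => ZMod 2).sum_comp F, Fintype.sum_prod_type]
  exact Fin.sum_univ_two fun a : ZMod 2 => ∑ y : Cube n, F (Fin.cons a y)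

lemma cons_add_single_zero {n : ℕ} (a : ZMod 2) (y : Cube n) :
    (Fin.cons a y + Pi.single 0 1 : Cube (n + 1)) = Fin.cons (a + 1) y := by
  funext i
  refine Fin.cases ?_ (fun j => ?_) i <;> simp

lemma cons_add_single_succ {n : ℕ} (a : ZMod 2) (y : Cube n) (i : Fin n) :
    (Fin.cons a y + Pi.single i.succ 1 : Cube (n + 1)) = Fin.cons a (y + Pi.single i 1) := by
  funext j
  refine Fin.cases ?_ (fun k => ?_) j
  · simp
  · simp [Pi.single_apply, Fin.succ_inj]

/-- Logarithmic Sobolev form of the Faber–Krahn inequality on the cube. -/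
lemma sum_mul_shift_le_entropy {m σ η : ℝ}
    (h : ∀ p ∈ Set.Icc (0 : ℝ) 1, 2 * √(p * (1 - p)) ≤ σ + m * (Real.binEntropy p - η))
    {n : ℕ} (w : Cube n → ℝ) :
    ∑ x, ∑ i, w x * w (x + Pi.single i 1) ≤ n * (σ - m * η) * ∑ x, w x ^ 2 +
      m * (∑ x, Real.negMulLog (w x ^ 2) - Real.negMulLog (∑ x, w x ^ 2)) := by
  induction n with
  | zero => simp
  | succ n ih =>
    have h0 := ih fun y => w (Fin.cons 0 y)
    have h1 := ih fun y => w (Fin.cons 1 y)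
    -- Edges in the new direction join the two faces. Cauchy–Schwarz reduces them to the face
    -- masses, where the two-point inequality applies; its entropy term is what the induction
    -- hypotheses on the faces lack.
    have hc := Real.sum_mul_le_sqrt_mul_sqrt Finset.univ (fun y : Cube n => w (Fin.cons 0 y))
      fun y => w (Fin.cons 1 y)
    have ht := two_sqrt_mul_le h
      (Finset.univ.sum_nonneg fun (y : Cube n) _ => sq_nonneg (w (Fin.cons 0 y)))
      (Finset.univ.sum_nonneg fun (y : Cube n) _ => sq_nonneg (w (Fin.cons 1 y)))
    have h11 : (1 : ZMod 2) + 1 = 0 := by decide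
    have hsym : ∑ y : Cube n, w (Fin.cons 1 y) * w (Fin.cons 0 y) =
        ∑ y : Cube n, w (Fin.cons 0 y) * w (Fin.cons 1 y) :=
      Finset.sum_congr rfl fun _ _ => mul_comm _ _
    simp only [sum_cube_succ, Fin.sum_univ_succ, cons_add_single_zero, cons_add_single_succ,
      Finset.sum_add_distrib, zero_add, h11, hsym]
    push_cast
    linarith

/-- Jensen's inequality for the concave `negMulLog`: entropy is at most the logarithm of the support
size, here scaled by the total mass. -/
lemma sum_negMulLog_le {ι : Type*} [Fintype ι] (S : Finset ι) (v : ι → ℝ) (hv : ∀ x, 0 ≤ v x)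
    (hS : ∀ x, x ∉ S → v x = 0) :
    ∑ x, Real.negMulLog (v x) - Real.negMulLog (∑ x, v x) ≤ (∑ x, v x) * Real.log S.card := by
  have e1 : ∑ x, v x = ∑ x ∈ S, v x :=
    (Finset.sum_subset S.subset_univ fun x _ hx => hS x hx).symm
  have e2 : ∑ x, Real.negMulLog (v x) = ∑ x ∈ S, Real.negMulLog (v x) :=
    (Finset.sum_subset S.subset_univ fun x _ hx => by rw [hS x hx, Real.negMulLog_zero]).symm
  rw [e1, e2]
  rcases S.eq_empty_or_nonempty with rfl | hne
  · simp
  have hc : (0 : ℝ) < S.card := by exact_mod_cast hne.card_pos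
  have h := Real.concaveOn_negMulLog.le_map_sum (t := S) (w := fun _ => (S.card : ℝ)⁻¹) (p := v)
    (fun _ _ => by positivity) (by simp [hc.ne']) fun x _ => hv x
  simp only [smul_eq_mul, ← Finset.mul_sum] at h
  rcases (Finset.sum_nonneg fun x (_ : x ∈ S) => hv x).eq_or_lt with h0 | hpos
  · rw [← h0] at h ⊢
    simp only [mul_zero, Real.negMulLog_zero, zero_mul, sub_zero] at h ⊢
    exact nonpos_of_mul_nonpos_right h (by positivity)
  · rw [inv_mul_le_iff₀ hc] at h
    rw [Real.negMulLog, Real.log_mul (by positivity) hpos.ne', Real.log_inv] at h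
    simp only [Real.negMulLog] at h ⊢
    have : (S.card : ℝ) * (-((S.card : ℝ)⁻¹ * ∑ x ∈ S, v x) *
        (-Real.log S.card + Real.log (∑ x ∈ S, v x))) =
        -(∑ x ∈ S, v x) * (-Real.log S.card + Real.log (∑ x ∈ S, v x)) := by
      field_simp
    linarith

/-- Faber–Krahn inequality on the cube. -/
lemma sum_mul_shift_le {ρ : ℝ} (h0 : 0 < ρ) (h1 : ρ < 1 / 2) {n : ℕ} (S : Finset (Cube n))
    (hS : (S.card : ℝ) ≤ Real.exp (n * Real.binEntropy ρ)) (w : Cube n → ℝ)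
    (hw : ∀ x, x ∉ S → w x = 0) :
    ∑ x, ∑ i, w x * w (x + Pi.single i 1) ≤ n * (2 * √(ρ * (1 - ρ))) * ∑ x, w x ^ 2 := by
  obtain ⟨m, hm, h⟩ := two_sqrt_le_tangent h0 h1
  refine (sum_mul_shift_le_entropy h w).trans ?_
  have hlog : Real.log S.card ≤ n * Real.binEntropy ρ := by
    rcases S.eq_empty_or_nonempty with rfl | hne
    · have := Real.binEntropy_nonneg h0.le (by linarith : ρ ≤ 1)
      simp only [Finset.card_empty, Nat.cast_zero, Real.log_zero]
      positivity
    · rw [Real.log_le_iff_le_exp (by exact_mod_cast hne.card_pos)]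
      exact hS
  have h2 := sum_negMulLog_le S (fun x => w x ^ 2) (fun _ => sq_nonneg _)
    fun x hx => by simp [hw x hx]
  have h3 : 0 ≤ ∑ x, w x ^ 2 := Finset.sum_nonneg fun _ _ => sq_nonneg _
  have h4 := mul_le_mul_of_nonneg_left (h2.trans (mul_le_mul_of_nonneg_left hlog h3)) hm
  linarith

/-- Faber–Krahn controls a quadratic form, whereas iteration needs a norm bound. Applying it to `w =
√(Λ²|f|² + |Af|²)` gives `2Λ‖Af‖² ≤ Λ(Λ²‖f‖² + ‖Af‖²)`, and one `‖Af‖²` is absorbed. -/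
lemma sqSum_adjacency_le {ρ : ℝ} (h0 : 0 < ρ) (h1 : ρ < 1 / 2) {n : ℕ} (S : Finset (Cube n))
    (hS : (S.card : ℝ) ≤ Real.exp (n * Real.binEntropy ρ)) (f : Cube n → ℂ)
    (hf : ∀ x, x ∉ S → f x = 0) (hAf : ∀ x, x ∉ S → adjacency f x = 0) :
    sqSum (adjacency f) ≤ (n * (2 * √(ρ * (1 - ρ)))) ^ 2 * sqSum f := by
  rcases n.eq_zero_or_pos with rfl | hn
  · simp [sqSum, adjacency]
  set Λ : ℝ := n * (2 * √(ρ * (1 - ρ))) with hΛ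
  have hΛ0 : 0 < Λ := by
    have : 0 < ρ * (1 - ρ) := mul_pos h0 (by linarith)
    positivity
  set g := adjacency f with hg
  set w : Cube n → ℝ := fun x => √(Λ ^ 2 * ‖f x‖ ^ 2 + ‖g x‖ ^ 2) with hw
  have hwsq : ∀ x, w x ^ 2 = Λ ^ 2 * ‖f x‖ ^ 2 + ‖g x‖ ^ 2 := fun x =>
    Real.sq_sqrt (by positivity)
  have hFK := sum_mul_shift_le h0 h1 S hS w fun x hx => by simp [hw, hf x hx, hAf x hx]
  have hwsum : ∑ x, w x ^ 2 = Λ ^ 2 * sqSum f + sqSum g := by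
    simp only [hwsq, Finset.sum_add_distrib, ← Finset.mul_sum, sqSum]
  rw [hwsum] at hFK
  have hpair : ∀ x y, Λ * (‖f x‖ * ‖g y‖ + ‖f y‖ * ‖g x‖) ≤ w x * w y := by
    intro x y
    rw [hw, ← Real.sqrt_mul (by positivity)]
    refine Real.le_sqrt_of_sq_le ?_
    -- The squares of the two sides differ by exactly this square.
    nlinarith [sq_nonneg (Λ ^ 2 * (‖f x‖ * ‖f y‖) - ‖g x‖ * ‖g y‖)]
  have hsum : ∑ x, ∑ i, Λ * (‖f x‖ * ‖g (x + Pi.single i 1)‖ + ‖f (x + Pi.single i 1)‖ * ‖g x‖) ≤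
      ∑ x, ∑ i, w x * w (x + Pi.single i 1) :=
    Finset.sum_le_sum fun x _ => Finset.sum_le_sum fun i _ => hpair _ _
  have hsymm : ∑ x, ∑ i, ‖f x‖ * ‖g (x + Pi.single i 1)‖ =
      ∑ x, ∑ i, ‖f (x + Pi.single i 1)‖ * ‖g x‖ := by
    rw [Finset.sum_comm, Finset.sum_comm (s := Finset.univ (α := Cube n))]
    refine Finset.sum_congr rfl fun i _ => ?_
    rw [← sum_shift_single i]
    simp only [single_add_single_self]
  have hlow : sqSum g ≤ ∑ x, ∑ i, ‖f (x + Pi.single i 1)‖ * ‖g x‖ := by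
    refine Finset.sum_le_sum fun x _ => ?_
    rw [← Finset.sum_mul, sq]
    exact mul_le_mul_of_nonneg_right (norm_sum_le _ _) (norm_nonneg _)
  have hdist : ∑ x, ∑ i,
      Λ * (‖f x‖ * ‖g (x + Pi.single i 1)‖ + ‖f (x + Pi.single i 1)‖ * ‖g x‖) =
      Λ * (∑ x, ∑ i, ‖f x‖ * ‖g (x + Pi.single i 1)‖ +
        ∑ x, ∑ i, ‖f (x + Pi.single i 1)‖ * ‖g x‖) := by
    simp only [Finset.mul_sum, mul_add, Finset.sum_add_distrib]
  rw [hdist, hsymm] at hsum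
  have hfin : Λ * (2 * sqSum g) ≤ Λ * (Λ ^ 2 * sqSum f + sqSum g) := by
    refine le_trans ?_ (hsum.trans hFK)
    exact mul_le_mul_of_nonneg_left (by linarith) hΛ0.le
  linarith [le_of_mul_le_mul_left hfin hΛ0]

/-! ### Neighbourhoods of `S` and powers of the adjacency operator. -/

lemma adjacency_iterate_eq_zero {n : ℕ} {S : Set (Cube n)} {f : Cube n → ℂ}
    (hf : f ∈ suppSpace S) (j : ℕ) {x : Cube n}
    (hx : ∀ s ∈ S, j < hammingDist x s) : adjacency^[j] f x = 0 := by
  induction j generalizing x with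
  | zero =>
    by_contra h
    simpa using hx x (hf h)
  | succ j ih =>
    rw [Function.iterate_succ_apply']
    refine Finset.sum_eq_zero fun i _ => ih fun s hs => ?_
    have h1 := hammingDist_triangle x (x + Pi.single i 1) s
    have h2 : hammingDist x (x + Pi.single i 1) ≤ 1 := by
      rw [hammingDist_eq_hammingNorm, neg_add_cancel_left, hammingNorm]
      refine Finset.card_le_one.mpr fun a ha b hb => ?_
      simp only [Finset.mem_filter, Finset.mem_univ, true_and, Pi.single_apply, ne_eq,
        ite_eq_right_iff, Classical.not_imp] at ha hb
      rw [ha.1, hb.1]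
    have h3 := hx s hs
    omega

/-- Markov's inequality for the generating function `∑ r^|x| = (1+r)^n`. -/
lemma card_hammingNorm_le_mul_pow_le {n k : ℕ} {r : ℝ} (h0 : 0 < r) (h1 : r ≤ 1) :
    ((Finset.univ.filter fun x : Cube n => hammingNorm x ≤ k).card : ℝ) * r ^ k ≤
      (1 + r) ^ n := by
  have h : ∑ x : Cube n, r ^ hammingNorm x = (1 + r) ^ n := by
    simp only [pow_hammingNorm_eq_prod]
    rw [sum_prod_apply fun _ a => if a = 0 then (1 : ℝ) else r]
    simp
  rw [← h, ← nsmul_eq_mul, ← Finset.sum_const]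
  refine (Finset.sum_le_sum fun x hx => ?_).trans
    (Finset.sum_le_univ_sum_of_nonneg fun _ => by positivity)
  exact pow_le_pow_of_le_one h0.le h1 (Finset.mem_filter.mp hx).2

/-- Hamming balls of small relative radius have small exponential size. -/
lemma exists_card_ball_le {γ : ℝ} (hγ : 0 < γ) :
    ∃ δ : ℝ, 0 < δ ∧ ∀ n k : ℕ, (k : ℝ) ≤ δ * n →
      ((Finset.univ.filter fun x : Cube n => hammingNorm x ≤ k).card : ℝ) ≤ Real.exp (n * γ) := by
  -- Half of the exponent `γ` pays for `(1+r)^n`, the other half, through `δ`, for `r^(-k)`.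
  set r : ℝ := min (γ / 2) (1 / 2) with hr
  have hr0 : 0 < r := lt_min (by positivity) (by norm_num)
  have hr1 : r < 1 := (min_le_right _ _).trans_lt (by norm_num)
  have hlog : 0 < -Real.log r := neg_pos.mpr (Real.log_neg hr0 hr1)
  refine ⟨γ / 2 / (-Real.log r), by positivity, fun n k hk => ?_⟩
  have h := card_hammingNorm_le_mul_pow_le (n := n) (k := k) hr0 hr1.le
  rw [← le_div_iff₀ (by positivity)] at h
  refine h.trans ?_
  rw [div_le_iff₀ (by positivity)]
  have h1 : (1 + r) ^ n ≤ Real.exp (n * (γ / 2)) := by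
    rw [Real.exp_nat_mul]
    refine pow_le_pow_left₀ (by positivity) ?_ n
    have := Real.add_one_le_exp (γ / 2)
    linarith [min_le_left (γ / 2) (1 / 2)]
  have h2 : Real.exp (-(n * (γ / 2))) ≤ r ^ k := by
    rw [← Real.exp_log hr0, ← Real.exp_nat_mul, Real.exp_le_exp]
    rw [div_mul_eq_mul_div, le_div_iff₀ hlog] at hk
    linarith
  calc (1 + r) ^ n ≤ Real.exp (n * (γ / 2)) := h1
    _ = Real.exp (n * γ) * Real.exp (-(n * (γ / 2))) := by
      rw [← Real.exp_add]
      ring_nf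
    _ ≤ _ := mul_le_mul_of_nonneg_left h2 (Real.exp_pos _).le

open Classical in
lemma card_thickening_le {n : ℕ} (S : Set (Cube n)) (k : ℕ) :
    (Finset.univ.filter fun x : Cube n => ∃ s ∈ S, hammingDist x s ≤ k).card ≤
      S.ncard * (Finset.univ.filter fun x : Cube n => hammingNorm x ≤ k).card := by
  rw [Set.ncard_eq_toFinset_card']
  refine (Finset.card_le_card fun x hx => ?_).trans (Finset.card_image₂_le (· + ·) _ _)
  obtain ⟨s, hs, hd⟩ := (Finset.mem_filter.mp hx).2
  rw [Finset.mem_image₂]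
  refine ⟨s, Set.mem_toFinset.mpr hs, -s + x, Finset.mem_filter.mpr ⟨Finset.mem_univ _, ?_⟩,
    add_neg_cancel_left s x⟩
  rwa [← hammingDist_eq_hammingNorm, hammingDist_comm]

-- One set, the `k`-neighbourhood of `S`, supports every `A^j f` with `j ≤ k`, so the same norm
-- bound applies at each step.
open Classical in
lemma sqSum_adjacency_iterate_le {ρ : ℝ} (h0 : 0 < ρ) (h1 : ρ < 1 / 2) {n : ℕ} {S : Set (Cube n)}
    {f : Cube n → ℂ} (hf : f ∈ suppSpace S) (k : ℕ)
    (hS : ((Finset.univ.filter fun x : Cube n => ∃ s ∈ S, hammingDist x s ≤ k).card : ℝ) ≤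
      Real.exp (n * Real.binEntropy ρ)) :
    sqSum (adjacency^[k] f) ≤ (n * (2 * √(ρ * (1 - ρ)))) ^ (2 * k) * sqSum f := by
  have hz : ∀ j ≤ k, ∀ x, x ∉ (Finset.univ.filter fun x : Cube n =>
      ∃ s ∈ S, hammingDist x s ≤ k) → adjacency^[j] f x = 0 := by
    intro j hj x hx
    simp only [Finset.mem_filter, Finset.mem_univ, true_and, not_exists, not_and, not_le] at hx
    exact adjacency_iterate_eq_zero hf j fun s hs => hj.trans_lt (hx s hs)
  have key : ∀ j ≤ k, sqSum (adjacency^[j] f) ≤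
      (n * (2 * √(ρ * (1 - ρ)))) ^ (2 * j) * sqSum f := by
    intro j
    induction j with
    | zero => simp
    | succ j ih =>
      intro hj
      have h2 := hz (j + 1) hj
      simp only [Function.iterate_succ_apply'] at h2 ⊢
      refine (sqSum_adjacency_le h0 h1 _ hS _ (hz j (by omega)) h2).trans ?_
      refine (mul_le_mul_of_nonneg_left (ih (by omega)) (by positivity)).trans (le_of_eq ?_)
      generalize (n : ℝ) * (2 * √(ρ * (1 - ρ))) = Λ
      ring
  exact key k le_rfl

/-- By Parseval only frequencies in the ball contribute to the inner product, and there each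
eigenvalue is at least `n(1 - 2ρ)`. -/
lemma norm_sum_mul_conj_le_of_fourierSupp {n : ℕ} {ρ : ℝ} (hρ : ρ < 1 / 2)
    (f : Cube n → ℂ) {g : Cube n → ℂ} (hg : g ∈ fourierSuppSpace (hammingBall n (ρ * n)))
    (k : ℕ) :
    (n * (1 - 2 * ρ)) ^ k * ‖∑ x, f x * starRingEnd ℂ (g x)‖ ≤
      √(sqSum (adjacency^[k] f)) * √(sqSum g) := by
  classical
  set T := Finset.univ.filter fun ω : Cube n => ω ∈ hammingBall n (ρ * n) with hT
  have hg0 : ∀ ω, ω ∉ T → fourier n g ω = 0 := by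
    intro ω hω
    by_contra h
    exact hω (Finset.mem_filter.mpr ⟨Finset.mem_univ _, hg h⟩)
  have hθ : 0 ≤ n * (1 - 2 * ρ) := mul_nonneg n.cast_nonneg (by linarith)
  have h2n : (0 : ℝ) < 2 ^ n := by positivity
  have e1 : (2 : ℝ) ^ n * ‖∑ x, f x * starRingEnd ℂ (g x)‖ =
      ‖∑ ω ∈ T, fourier n f ω * starRingEnd ℂ (fourier n g ω)‖ := by
    rw [Finset.sum_subset T.subset_univ fun ω _ hω => by rw [hg0 ω hω]; simp, parseval, norm_mul]
    simp
  have e2 : √(∑ ω ∈ T, ‖fourier n g ω‖ ^ 2) ≤ √(2 ^ n) * √(sqSum g) := by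
    rw [← Real.sqrt_mul h2n.le, ← sqSum_fourier]
    exact Real.sqrt_le_sqrt (Finset.sum_le_univ_sum_of_nonneg fun _ => by positivity)
  have e3 : (n * (1 - 2 * ρ)) ^ k * √(∑ ω ∈ T, ‖fourier n f ω‖ ^ 2) ≤
      √(2 ^ n) * √(sqSum (adjacency^[k] f)) := by
    rw [← Real.sqrt_mul h2n.le, ← sqSum_fourier]
    refine Real.le_sqrt_of_sq_le ?_
    rw [mul_pow, Real.sq_sqrt (Finset.sum_nonneg fun _ _ => by positivity), Finset.mul_sum]
    refine le_trans (Finset.sum_le_sum fun ω hω => ?_)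
      (Finset.sum_le_univ_sum_of_nonneg (s := T)
        (f := fun ω => ‖fourier n (adjacency^[k] f) ω‖ ^ 2) fun _ => by positivity)
    rw [fourier_adjacency_iterate, norm_mul, mul_pow ‖((n : ℂ) - 2 * hammingNorm ω) ^ k‖]
    refine mul_le_mul_of_nonneg_right ?_ (sq_nonneg _)
    rw [norm_pow]
    refine pow_le_pow_left₀ (pow_nonneg hθ k) (pow_le_pow_left₀ hθ ?_ k) 2
    have hω' : (hammingNorm ω : ℝ) ≤ ρ * n := (Finset.mem_filter.mp hω).2
    have : ((n : ℂ) - 2 * hammingNorm ω) = ((n - 2 * hammingNorm ω : ℝ) : ℂ) := by push_cast; rfl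
    rw [this, Complex.norm_real]
    exact le_trans (by linarith) (le_abs_self _)
  refine le_of_mul_le_mul_left ?_ h2n
  calc (2 : ℝ) ^ n * ((n * (1 - 2 * ρ)) ^ k * ‖∑ x, f x * starRingEnd ℂ (g x)‖)
      = (n * (1 - 2 * ρ)) ^ k * (2 ^ n * ‖∑ x, f x * starRingEnd ℂ (g x)‖) :=
        mul_left_comm _ _ _
    _ ≤ (n * (1 - 2 * ρ)) ^ k *
        (√(∑ ω ∈ T, ‖fourier n f ω‖ ^ 2) * √(∑ ω ∈ T, ‖fourier n g ω‖ ^ 2)) := by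
      rw [e1]
      exact mul_le_mul_of_nonneg_left (norm_sum_mul_conj_le _ _ _) (pow_nonneg hθ k)
    _ ≤ (√(2 ^ n) * √(sqSum (adjacency^[k] f))) * (√(2 ^ n) * √(sqSum g)) := by
      rw [← mul_assoc]
      exact mul_le_mul e3 e2 (Real.sqrt_nonneg _)
        (mul_nonneg (Real.sqrt_nonneg _) (Real.sqrt_nonneg _))
    _ = 2 ^ n * (√(sqSum (adjacency^[k] f)) * √(sqSum g)) := by
      rw [mul_mul_mul_comm, Real.mul_self_sqrt h2n.le]

/-! ### The exponential upper bound on the cosine. -/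

lemma exists_entropy_gap {ρ θ : ℝ} (h0 : 0 ≤ ρ) (h1 : ρ < 1 / 2) (hθ : 2 * √(ρ * (1 - ρ)) < θ) :
    ∃ ρ', 0 < ρ' ∧ ρ' < 1 / 2 ∧ Real.binEntropy ρ < Real.binEntropy ρ' ∧
      2 * √(ρ' * (1 - ρ')) < θ := by
  have hc : ContinuousAt (fun p : ℝ => 2 * √(p * (1 - p))) ρ := by fun_prop
  have hev : ∀ᶠ p in nhdsWithin ρ (Set.Ioi ρ), 2 * √(p * (1 - p)) < θ :=
    (hc.eventually_lt continuousAt_const hθ).filter_mono nhdsWithin_le_nhds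
  obtain ⟨p, hp, hp1, hp2⟩ := (hev.and (Ioo_mem_nhdsGT h1)).exists
  refine ⟨p, h0.trans_lt hp1, hp2, ?_, hp⟩
  exact Real.binEntropy_strictMonoOn ⟨h0, by linarith⟩ ⟨by linarith, by linarith⟩ hp1

theorem cosAngle_le_exp {ρ₁ ρ₂ : ℝ} (h₁ : ρ₁ ∈ Set.Icc (0 : ℝ) (1 / 2))
    (h₂ : ρ₂ ∈ Set.Icc (0 : ℝ) (1 / 2)) (h : (1 - 2 * ρ₁) ^ 2 + (1 - 2 * ρ₂) ^ 2 > 1) :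
    ∃ ε : ℝ, 0 < ε ∧ ∃ n₀ : ℕ, ∀ n : ℕ, n₀ ≤ n → ∀ S : Set (Cube n),
      (S.ncard : ℝ) ≤ Real.exp (n * Real.binEntropy ρ₁) →
      cosAngle (suppSpace S) (fourierSuppSpace (hammingBall n (ρ₂ * n))) ≤
        Real.exp (-(n * ε)) := by
  obtain ⟨h10, h11⟩ := h₁
  obtain ⟨h20, h21⟩ := h₂
  have h11' : ρ₁ < 1 / 2 := by
    refine lt_of_le_of_ne h11 ?_
    rintro rfl
    nlinarith
  have h21' : ρ₂ < 1 / 2 := by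
    refine lt_of_le_of_ne h21 ?_
    rintro rfl
    nlinarith
  set θ := 1 - 2 * ρ₂ with hθ
  have hθ0 : 0 < θ := by linarith
  -- The circle condition enters here, through `4ρ₁(1-ρ₁) = 1 - (1-2ρ₁)²`.
  have hlt : 2 * √(ρ₁ * (1 - ρ₁)) < θ := by
    have hq : 0 ≤ ρ₁ * (1 - ρ₁) := mul_nonneg h10 (by linarith)
    refine lt_of_pow_lt_pow_left₀ 2 hθ0.le ?_
    rw [mul_pow, Real.sq_sqrt hq]
    linarith
  obtain ⟨ρ, hρ0, hρ1, hent, hρθ⟩ := exists_entropy_gap h10 h11' hlt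
  set σ := 2 * √(ρ * (1 - ρ)) with hσ
  have hσ0 : 0 < σ := by
    have : 0 < ρ * (1 - ρ) := mul_pos hρ0 (by linarith)
    positivity
  obtain ⟨δ, hδ, hball⟩ := exists_card_ball_le (sub_pos.mpr hent)
  have hlog : 0 < Real.log (θ / σ) := Real.log_pos ((one_lt_div hσ0).mpr hρθ)
  -- The threshold gives `δn ≥ 2`, so the floor `k` of `δn` is at least `δn/2` and `(σ/θ)^k` decays
  -- at this rate.
  refine ⟨δ / 2 * Real.log (θ / σ), by positivity, ⌈2 / δ⌉₊, fun n hn S hS => ?_⟩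
  classical
  have hn' : 2 / δ ≤ n := Nat.ceil_le.mp hn
  have hn0 : (0 : ℝ) < n := lt_of_lt_of_le (by positivity) hn'
  rw [div_le_iff₀ hδ] at hn'
  set k := ⌊δ * n⌋₊ with hk
  have hk1 : (k : ℝ) ≤ δ * n := Nat.floor_le (by positivity)
  have hk2 : δ / 2 * n ≤ k := by
    have := Nat.lt_floor_add_one (δ * n)
    linarith
  have hcard : ((Finset.univ.filter fun x : Cube n => ∃ s ∈ S, hammingDist x s ≤ k).card : ℝ) ≤
      Real.exp (n * Real.binEntropy ρ) := by
    calc ((Finset.univ.filter fun x : Cube n => ∃ s ∈ S, hammingDist x s ≤ k).card : ℝ)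
        ≤ S.ncard * (Finset.univ.filter fun x : Cube n => hammingNorm x ≤ k).card := by
          exact_mod_cast card_thickening_le S k
      _ ≤ Real.exp (n * Real.binEntropy ρ₁) *
          Real.exp (n * (Real.binEntropy ρ - Real.binEntropy ρ₁)) :=
        mul_le_mul hS (hball n k hk1) (by positivity) (Real.exp_pos _).le
      _ = Real.exp (n * Real.binEntropy ρ) := by
        rw [← Real.exp_add]
        ring_nf
  refine cosAngle_le (Real.exp_pos _).le fun f hf g hg => ?_
  have hlow := norm_sum_mul_conj_le_of_fourierSupp h21' f hg k
  have hup := sqSum_adjacency_iterate_le hρ0 hρ1 hf k hcard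
  rw [← hσ] at hup
  rw [← hθ] at hlow
  have hup' : √(sqSum (adjacency^[k] f)) ≤ (n * σ) ^ k * √(sqSum f) := by
    refine (Real.sqrt_le_sqrt hup).trans (le_of_eq ?_)
    rw [mul_comm 2 k, pow_mul, Real.sqrt_mul (by positivity), Real.sqrt_sq (by positivity)]
  have hratio : σ ^ k ≤ θ ^ k * Real.exp (-(n * (δ / 2 * Real.log (θ / σ)))) := by
    have e : σ ^ k = θ ^ k * Real.exp (-(k * Real.log (θ / σ))) := by
      rw [Real.exp_neg, Real.exp_nat_mul, Real.exp_log (by positivity), div_pow]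
      field_simp
    rw [e]
    refine mul_le_mul_of_nonneg_left (Real.exp_le_exp.mpr (neg_le_neg ?_)) (by positivity)
    have := mul_le_mul_of_nonneg_right hk2 hlog.le
    linarith
  refine le_of_mul_le_mul_left (hlow.trans ?_) (by positivity : 0 < (n * θ) ^ k)
  calc √(sqSum (adjacency^[k] f)) * √(sqSum g)
      ≤ (n * σ) ^ k * √(sqSum f) * √(sqSum g) :=
        mul_le_mul_of_nonneg_right hup' (Real.sqrt_nonneg _)
    _ = σ ^ k * (n ^ k * (√(sqSum f) * √(sqSum g))) := by ring
    _ ≤ θ ^ k * Real.exp (-(n * (δ / 2 * Real.log (θ / σ)))) *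
        (n ^ k * (√(sqSum f) * √(sqSum g))) := mul_le_mul_of_nonneg_right hratio (by positivity)
    _ = (n * θ) ^ k * (Real.exp (-(n * (δ / 2 * Real.log (θ / σ)))) *
        (√(sqSum f) * √(sqSum g))) := by rw [mul_pow]; ring

/-! ### Tensor powers and the lower bound on the cosine. -/

/-- Chernoff bound for the Hamming weight under a product measure. -/
lemma exists_sum_prod_tail_le {w₀ w₁ ρ : ℝ} (h0 : 0 ≤ w₀) (h1 : 0 ≤ w₁) (hs : w₀ + w₁ = 1)
    (hρ : w₁ < ρ) :
    ∃ ε : ℝ, 0 < ε ∧ ∀ (n : ℕ) (S : Finset (Cube n)),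
      (∀ x ∈ S, ρ * n < hammingNorm x) →
      ∑ x ∈ S, ∏ i, (if x i = 0 then w₀ else w₁) ≤ Real.exp (-(n * ε)) := by
  have hρ0 : 0 < ρ := h1.trans_lt hρ
  -- `t ≤ 1` allows `e^t ≤ 1 + t + t²`; the last condition, with `w₁ < ρ`, keeps the rate `ρt - w₁(t
  -- + t²)` positive.
  obtain ⟨t, ht0, ht1, ht2⟩ : ∃ t : ℝ, 0 < t ∧ t ≤ 1 ∧ t * (2 * ρ) ≤ ρ - w₁ :=
    ⟨min 1 ((ρ - w₁) / (2 * ρ)), lt_min one_pos (div_pos (by linarith) (by linarith)),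
      min_le_left _ _, (le_div_iff₀ (by positivity)).mp (min_le_right _ _)⟩
  have hexp : Real.exp t ≤ 1 + t + t ^ 2 := by
    have := Real.abs_exp_sub_one_sub_id_le (x := t) (by rw [abs_of_pos ht0]; exact ht1)
    linarith [(abs_le.mp this).2]
  have hgap : 0 < t * (ρ - w₁ - w₁ * t) := by
    refine mul_pos ht0 ?_
    linarith [mul_le_mul_of_nonneg_right hρ.le ht0.le, mul_pos hρ0 ht0]
  refine ⟨ρ * t - w₁ * (t + t ^ 2), by linarith, fun n S hS => ?_⟩
  have hw : ∀ x : Cube n, 0 ≤ ∏ i, (if x i = 0 then w₀ else w₁) := fun x =>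
    Finset.prod_nonneg fun i _ => by split_ifs <;> assumption
  have hpt : ∀ x ∈ S, ∏ i, (if x i = 0 then w₀ else w₁) ≤ Real.exp (-(ρ * n * t)) *
      ∏ i, (if x i = 0 then w₀ else w₁ * Real.exp t) := by
    intro x hx
    have e : ∏ i, (if x i = 0 then w₀ else w₁ * Real.exp t) =
        (∏ i, (if x i = 0 then w₀ else w₁)) * Real.exp t ^ hammingNorm x := by
      rw [pow_hammingNorm_eq_prod, ← Finset.prod_mul_distrib]
      refine Finset.prod_congr rfl fun i _ => ?_
      split_ifs <;> simp
    rw [e, ← Real.exp_nat_mul, mul_left_comm, ← Real.exp_add]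
    refine le_mul_of_one_le_right (hw x) (Real.one_le_exp ?_)
    have := mul_le_mul_of_nonneg_right (hS x hx).le ht0.le
    linarith
  calc ∑ x ∈ S, ∏ i, (if x i = 0 then w₀ else w₁)
      ≤ ∑ x ∈ S, Real.exp (-(ρ * n * t)) * ∏ i, (if x i = 0 then w₀ else w₁ * Real.exp t) :=
        Finset.sum_le_sum hpt
    _ ≤ ∑ x : Cube n, Real.exp (-(ρ * n * t)) * ∏ i, (if x i = 0 then w₀ else w₁ * Real.exp t) :=
        Finset.sum_le_univ_sum_of_nonneg fun x => mul_nonneg (Real.exp_pos _).le <|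
          Finset.prod_nonneg fun i _ => by split_ifs <;> positivity
    _ = Real.exp (-(ρ * n * t)) * (w₀ + w₁ * Real.exp t) ^ n := by
        rw [← Finset.mul_sum,
          sum_prod_apply fun _ a => if a = 0 then w₀ else w₁ * Real.exp t]
        simp
    _ ≤ Real.exp (-(ρ * n * t)) * Real.exp (n * (w₁ * (t + t ^ 2))) := by
        refine mul_le_mul_of_nonneg_left ?_ (Real.exp_pos _).le
        rw [Real.exp_nat_mul]
        refine pow_le_pow_left₀ (by positivity) ?_ n
        have h3 := Real.add_one_le_exp (w₁ * (t + t ^ 2))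
        have h4 := mul_le_mul_of_nonneg_left hexp h1
        linarith
    _ = Real.exp (-(n * (ρ * t - w₁ * (t + t ^ 2)))) := by
        rw [← Real.exp_add]
        ring_nf

/-- The tensor power of the function on `𝔽₂` with values `a`, `b`. -/
noncomputable def tensorPower (n : ℕ) (a b : ℝ) : Cube n → ℂ :=
  fun x => ∏ i, if x i = 0 then (a : ℂ) else b

lemma norm_tensorPower_sq {n : ℕ} (a b : ℝ) (x : Cube n) :
    ‖tensorPower n a b x‖ ^ 2 = ∏ i, if x i = 0 then a ^ 2 else b ^ 2 := by
  rw [tensorPower, norm_prod, ← Finset.prod_pow]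
  refine Finset.prod_congr rfl fun i _ => ?_
  split_ifs <;> simp

lemma sqSum_tensorPower {n : ℕ} {a b : ℝ} (h : a ^ 2 + b ^ 2 = 1) :
    sqSum (tensorPower n a b) = 1 := by
  simp only [sqSum, norm_tensorPower_sq]
  rw [sum_prod_apply fun _ c => if c = 0 then a ^ 2 else b ^ 2]
  simp [h]

lemma fourier_tensorPower {n : ℕ} (a b : ℝ) :
    fourier n (tensorPower n a b) = tensorPower n (a + b) (a - b) := by
  funext ω
  simp only [fourier_apply, tensorPower, character_eq_prod, ← Finset.prod_mul_distrib]
  rw [sum_prod_apply fun i c => (-1 : ℂ) ^ (ω i * c).val * if c = 0 then (a : ℂ) else b]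
  refine Finset.prod_congr rfl fun i _ => ?_
  rcases zmod_two_eq_zero_or_one (ω i) with h | h <;> simp [h, ZMod.val_one, sub_eq_add_neg]

lemma sqSum_sub_indicator {n : ℕ} (S : Set (Cube n)) [DecidablePred (· ∈ S)] (f : Cube n → ℂ) :
    sqSum (f - S.indicator f) = ∑ x with x ∉ S, ‖f x‖ ^ 2 := by
  rw [sqSum, Finset.sum_filter]
  refine Finset.sum_congr rfl fun x _ => ?_
  by_cases hx : x ∈ S <;> simp [hx]

lemma sqSum_indicator_le {n : ℕ} (S : Set (Cube n)) (f : Cube n → ℂ) :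
    sqSum (S.indicator f) ≤ sqSum f :=
  Finset.sum_le_sum fun x _ =>
    pow_le_pow_left₀ (norm_nonneg _) (norm_indicator_le_norm_self f x) 2

/-- The orthogonal projection onto the functions with spectrum in `T`. -/
noncomputable def fourierProj {n : ℕ} (T : Set (Cube n)) (f : Cube n → ℂ) : Cube n → ℂ :=
  ((2 : ℂ) ^ n)⁻¹ • fourier n (T.indicator (fourier n f))

lemma fourier_fourierProj {n : ℕ} (T : Set (Cube n)) (f : Cube n → ℂ) :
    fourier n (fourierProj T f) = T.indicator (fourier n f) := by
  rw [fourierProj, map_smul, fourier_fourier, inv_smul_smul₀ (pow_ne_zero n two_ne_zero)]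

lemma fourierProj_mem {n : ℕ} (T : Set (Cube n)) (f : Cube n → ℂ) :
    fourierProj T f ∈ fourierSuppSpace T := by
  change Function.support (fourier n (fourierProj T f)) ⊆ T
  rw [fourier_fourierProj]
  exact Set.support_indicator_subset

lemma sqSum_fourierProj_le {n : ℕ} (T : Set (Cube n)) (f : Cube n → ℂ) :
    sqSum (fourierProj T f) ≤ sqSum f := by
  have h := sqSum_indicator_le T (fourier n f)
  rw [← fourier_fourierProj, sqSum_fourier, sqSum_fourier] at h
  exact le_of_mul_le_mul_left h (by positivity)

lemma sqSum_sub_fourierProj {n : ℕ} (T : Set (Cube n)) [DecidablePred (· ∈ T)]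
    (f : Cube n → ℂ) :
    2 ^ n * sqSum (f - fourierProj T f) = ∑ ω with ω ∉ T, ‖fourier n f ω‖ ^ 2 := by
  rw [← sqSum_fourier, map_sub, fourier_fourierProj, sqSum_sub_indicator]

/-- Two subspaces close to a common unit vector form a small angle. -/
lemma one_sub_le_cosAngle {n : ℕ} {V₁ V₂ : Submodule ℂ (Cube n → ℂ)} {f g₁ g₂ : Cube n → ℂ}
    {e₁ e₂ : ℝ} (hf : sqSum f = 1) (h₁ : g₁ ∈ V₁) (h₂ : g₂ ∈ V₂) (hg₁ : sqSum g₁ ≤ 1)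
    (hg₂ : sqSum g₂ ≤ 1) (hd₁ : sqSum (f - g₁) ≤ e₁ ^ 2) (hd₂ : sqSum (f - g₂) ≤ e₂ ^ 2)
    (he₁ : 0 ≤ e₁) (he₂ : 0 ≤ e₂) (he : e₁ + e₂ < 1) :
    1 - (e₁ + e₂) ≤ cosAngle V₁ V₂ := by
  have hff : ∑ x, f x * starRingEnd ℂ (f x) = 1 := by
    simp only [Complex.mul_conj']
    unfold sqSum at hf
    exact_mod_cast hf
  -- `(g₁,g₂) = (f,f) - (f-g₁,g₂) - (f,f-g₂)`, with each error bounded by Cauchy–Schwarz.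
  have hdecomp : ∑ x, g₁ x * starRingEnd ℂ (g₂ x) = 1 -
      (∑ x, (f - g₁) x * starRingEnd ℂ (g₂ x) + ∑ x, f x * starRingEnd ℂ ((f - g₂) x)) := by
    rw [← hff, ← Finset.sum_add_distrib, ← Finset.sum_sub_distrib]
    refine Finset.sum_congr rfl fun x _ => ?_
    simp only [Pi.sub_apply, map_sub]
    ring
  have b₁ : ‖∑ x, (f - g₁) x * starRingEnd ℂ (g₂ x)‖ ≤ e₁ := by
    refine (norm_sum_mul_conj_le _ _ _).trans ?_
    calc √(sqSum (f - g₁)) * √(sqSum g₂) ≤ e₁ * 1 :=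
          mul_le_mul (Real.sqrt_le_iff.mpr ⟨he₁, hd₁⟩) (Real.sqrt_le_one.mpr hg₂)
            (Real.sqrt_nonneg _) he₁
      _ = e₁ := mul_one _
  have b₂ : ‖∑ x, f x * starRingEnd ℂ ((f - g₂) x)‖ ≤ e₂ := by
    refine (norm_sum_mul_conj_le _ _ _).trans ?_
    calc √(sqSum f) * √(sqSum (f - g₂)) ≤ 1 * e₂ :=
          mul_le_mul (Real.sqrt_le_one.mpr hf.le) (Real.sqrt_le_iff.mpr ⟨he₂, hd₂⟩)
            (Real.sqrt_nonneg _) zero_le_one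
      _ = e₂ := one_mul _
  have hlow : 1 - (e₁ + e₂) ≤ ‖∑ x, g₁ x * starRingEnd ℂ (g₂ x)‖ := by
    rw [hdecomp]
    refine le_trans ?_ (norm_sub_norm_le _ _)
    rw [norm_one]
    linarith [(norm_add_le (∑ x, (f - g₁) x * starRingEnd ℂ (g₂ x))
      (∑ x, f x * starRingEnd ℂ ((f - g₂) x))).trans (add_le_add b₁ b₂)]
  have hpos : 0 < ‖∑ x, g₁ x * starRingEnd ℂ (g₂ x)‖ := by linarith
  have h10 : g₁ ≠ 0 := by
    rintro rfl
    simp at hpos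
  have h20 : g₂ ≠ 0 := by
    rintro rfl
    simp at hpos
  refine hlow.trans (le_trans ?_ (le_cosAngle h₁ h₂ h10 h20))
  rw [le_div_iff₀ (mul_pos (Real.sqrt_pos.mpr (sqSum_pos h10)) (Real.sqrt_pos.mpr (sqSum_pos h20)))]
  refine mul_le_of_le_one_right hpos.le ?_
  exact mul_le_one₀ (Real.sqrt_le_one.mpr hg₁) (Real.sqrt_nonneg _) (Real.sqrt_le_one.mpr hg₂)

lemma one_sub_exp_le_cosAngle_of_circle {ρ₁ ρ₂ c s : ℝ} (hcs : c ^ 2 + s ^ 2 = 1) (hs : 0 ≤ s)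
    (hc1 : 1 - 2 * ρ₁ < c) (hs1 : 1 - 2 * ρ₂ < s) :
    ∃ ε : ℝ, 0 < ε ∧ ∃ n₀ : ℕ, ∀ n : ℕ, n₀ ≤ n →
      1 - Real.exp (-(n * ε)) ≤
        cosAngle (suppSpace (hammingBall n (ρ₁ * n)))
          (fourierSuppSpace (hammingBall n (ρ₂ * n))) := by
  classical
  obtain ⟨hcl, hcu⟩ := abs_le.mp (abs_le_one_iff_mul_self_le_one.mpr (by nlinarith : c * c ≤ 1))
  have hsu : s ≤ 1 := by nlinarith
  -- Half-angle choice: `b² = (1-c)/2 < ρ₁`, and `2ab = s` gives `(a-b)²/2 = (1-s)/2 < ρ₂`.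
  set a := √((1 + c) / 2) with ha
  set b := √((1 - c) / 2) with hb
  have ha2 : a ^ 2 = (1 + c) / 2 := Real.sq_sqrt (by linarith)
  have hb2 : b ^ 2 = (1 - c) / 2 := Real.sq_sqrt (by linarith)
  have hab : a * b = s / 2 := by
    rw [ha, hb, ← Real.sqrt_mul (by linarith)]
    rw [Real.sqrt_eq_iff_eq_sq (by nlinarith) (by linarith)]
    linarith
  have hunit : a ^ 2 + b ^ 2 = 1 := by rw [ha2, hb2]; ring
  obtain ⟨ε₁, hε₁, ht₁⟩ := exists_sum_prod_tail_le (w₀ := a ^ 2) (w₁ := b ^ 2) (ρ := ρ₁)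
    (sq_nonneg _) (sq_nonneg _) hunit (by linarith)
  obtain ⟨ε₂, hε₂, ht₂⟩ := exists_sum_prod_tail_le (w₀ := (a + b) ^ 2 / 2)
    (w₁ := (a - b) ^ 2 / 2) (ρ := ρ₂) (by positivity) (by positivity)
    (by linear_combination hunit) (by linarith)
  set ε := min ε₁ ε₂ with hε
  have hε0 : 0 < ε := lt_min hε₁ hε₂
  refine ⟨ε / 4, by positivity, ⌈4 / ε⌉₊, fun n hn => ?_⟩
  have hn' : 4 / ε ≤ n := Nat.ceil_le.mp hn
  rw [div_le_iff₀ hε0] at hn'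
  set e := Real.exp (-(n * (ε / 2))) with he
  have he2 : e ^ 2 = Real.exp (-(n * ε)) := by
    rw [he, ← Real.exp_nat_mul]
    push_cast
    ring_nf
  set f := tensorPower n a b with hf
  have hd₁ : sqSum (f - (hammingBall n (ρ₁ * n)).indicator f) ≤ e ^ 2 := by
    rw [sqSum_sub_indicator, he2]
    simp only [hf, norm_tensorPower_sq]
    refine (ht₁ n _ fun x hx => not_le.mp (Finset.mem_filter.mp hx).2).trans ?_
    exact Real.exp_le_exp.mpr (neg_le_neg
      (mul_le_mul_of_nonneg_left (min_le_left _ _) n.cast_nonneg))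
  have hd₂ : sqSum (f - fourierProj (hammingBall n (ρ₂ * n)) f) ≤ e ^ 2 := by
    have h2n : (0 : ℝ) < 2 ^ n := by positivity
    refine le_of_mul_le_mul_left ?_ h2n
    rw [sqSum_sub_fourierProj, hf, fourier_tensorPower, he2]
    have hpt : ∀ ω : Cube n, ‖tensorPower n (a + b) (a - b) ω‖ ^ 2 =
        2 ^ n * ∏ i, if ω i = 0 then (a + b) ^ 2 / 2 else (a - b) ^ 2 / 2 := by
      intro ω
      have : (2 : ℝ) ^ n = ∏ _i : Fin n, 2 := by simp
      rw [norm_tensorPower_sq, this, ← Finset.prod_mul_distrib]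
      refine Finset.prod_congr rfl fun i _ => ?_
      split_ifs <;> ring
    simp only [hpt, ← Finset.mul_sum]
    refine mul_le_mul_of_nonneg_left ?_ h2n.le
    refine (ht₂ n _ fun x hx => not_le.mp (Finset.mem_filter.mp hx).2).trans ?_
    exact Real.exp_le_exp.mpr (neg_le_neg
      (mul_le_mul_of_nonneg_left (min_le_right _ _) n.cast_nonneg))
  -- With `q = e^{-nε/4}`, `e = q²`; the threshold `nε ≥ 4` gives `q ≤ 1/2`, hence `2q² ≤ q`.
  have hsmall : e + e ≤ Real.exp (-(n * (ε / 4))) := by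
    have h1 : e = Real.exp (-(n * (ε / 4))) * Real.exp (-(n * (ε / 4))) := by
      rw [he, ← Real.exp_add]
      ring_nf
    have h2 : Real.exp (-(n * (ε / 4))) ≤ 1 / 2 := by
      rw [Real.exp_neg, ← one_div]
      refine one_div_le_one_div_of_le two_pos ?_
      linarith [Real.add_one_le_exp (n * (ε / 4))]
    rw [h1]
    nlinarith [Real.exp_pos (-(n * (ε / 4)))]
  have hlt1 : Real.exp (-(n * (ε / 4))) < 1 := by
    rw [Real.exp_lt_one_iff]
    linarith
  have hfu : sqSum f = 1 := sqSum_tensorPower hunit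
  have := one_sub_le_cosAngle (V₁ := suppSpace (hammingBall n (ρ₁ * n))) hfu
    Set.support_indicator_subset (fourierProj_mem _ f)
    ((sqSum_indicator_le _ f).trans hfu.le) ((sqSum_fourierProj_le _ f).trans hfu.le) hd₁ hd₂
    (Real.exp_pos _).le (Real.exp_pos _).le (hsmall.trans_lt hlt1)
  linarith

/-- Separate `rᵢ ≤ ρᵢ` are needed because `(1-2ρ)²` grows again beyond `1/2`; there `r = min ρ
(1/2)` is used. -/
theorem one_sub_exp_le_cosAngle {ρ₁ ρ₂ r₁ r₂ : ℝ} (hr₁ : r₁ ≤ ρ₁) (hr₂ : r₂ ≤ ρ₂) (h : (1 - 2 * r₁) ^ 2 + (1 - 2 * r₂) ^ 2 < 1) :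
    ∃ ε : ℝ, 0 < ε ∧ ∃ n₀ : ℕ, ∀ n : ℕ, n₀ ≤ n →
      1 - Real.exp (-(n * ε)) ≤
        cosAngle (suppSpace (hammingBall n (ρ₁ * n)))
          (fourierSuppSpace (hammingBall n (ρ₂ * n))) := by
  -- Half of the gap to the unit circle goes to each square, which puts `(c, s)` on the circle with
  -- both inequalities strict.
  set d := (1 - (1 - 2 * r₁) ^ 2 - (1 - 2 * r₂) ^ 2) / 2 with hd
  have hd0 : 0 < d := by linarith
  refine one_sub_exp_le_cosAngle_of_circle (c := √((1 - 2 * r₁) ^ 2 + d))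
    (s := √((1 - 2 * r₂) ^ 2 + d)) ?_ (Real.sqrt_nonneg _) ?_ ?_
  · rw [Real.sq_sqrt (by positivity), Real.sq_sqrt (by positivity)]
    linarith
  · exact lt_of_le_of_lt (by linarith : 1 - 2 * ρ₁ ≤ 1 - 2 * r₁)
      (Real.lt_sqrt_of_sq_lt (by linarith))
  · exact lt_of_le_of_lt (by linarith : 1 - 2 * ρ₂ ≤ 1 - 2 * r₂)
      (Real.lt_sqrt_of_sq_lt (by linarith))

end Hypercube

theorem mainTheorem1 :
    (∀ ρ₁ ∈ Set.Icc (0 : ℝ) (1 / 2), ∀ ρ₂ ∈ Set.Icc (0 : ℝ) (1 / 2),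
      (1 - 2 * ρ₁) ^ 2 + (1 - 2 * ρ₂) ^ 2 > 1 →
      ∃ ε : ℝ, 0 < ε ∧ ∃ n₀ : ℕ, ∀ n : ℕ, n₀ ≤ n →
        ∀ S : Set (Hypercube.Cube n),
          (S.ncard : ℝ) ≤ Real.exp (n * Real.binEntropy ρ₁) →
          Hypercube.cosAngle (Hypercube.suppSpace S)
              (Hypercube.fourierSuppSpace (Hypercube.hammingBall n (ρ₂ * n)))
            ≤ Real.exp (-(n * ε))) ∧
    (∀ ρ₁ ∈ Set.Icc (0 : ℝ) (1 / 2), ∀ ρ₂ ∈ Set.Icc (0 : ℝ) (1 / 2),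
      (1 - 2 * ρ₁) ^ 2 + (1 - 2 * ρ₂) ^ 2 < 1 →
      ∃ ε : ℝ, 0 < ε ∧ ∃ n₀ : ℕ, ∀ n : ℕ, n₀ ≤ n →
        1 - Real.exp (-(n * ε)) ≤
          Hypercube.cosAngle (Hypercube.suppSpace (Hypercube.hammingBall n (ρ₁ * n)))
            (Hypercube.fourierSuppSpace (Hypercube.hammingBall n (ρ₂ * n)))) ∧
    (∀ ρ₁ ρ₂ : ℝ, 0 ≤ ρ₁ → 0 ≤ ρ₂ → (1 / 2 < ρ₁ ∨ 1 / 2 < ρ₂) →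
      (1 - 2 * min ρ₁ (1 / 2)) ^ 2 + (1 - 2 * min ρ₂ (1 / 2)) ^ 2 < 1 →
      ∃ ε : ℝ, 0 < ε ∧ ∃ n₀ : ℕ, ∀ n : ℕ, n₀ ≤ n →
        1 - Real.exp (-(n * ε)) ≤
          Hypercube.cosAngle (Hypercube.suppSpace (Hypercube.hammingBall n (ρ₁ * n)))
            (Hypercube.fourierSuppSpace (Hypercube.hammingBall n (ρ₂ * n)))) := by
  refine ⟨fun ρ₁ h₁ ρ₂ h₂ h => Hypercube.cosAngle_le_exp h₁ h₂ h,
    fun ρ₁ _ ρ₂ _ h => Hypercube.one_sub_exp_le_cosAngle le_rfl le_rfl h,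
    fun ρ₁ ρ₂ _ _ _ h => Hypercube.one_sub_exp_le_cosAngle (min_le_left _ _) (min_le_left _ _) h⟩
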